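/- All graphs are finite and simple. For a graph $G$ with degree matrix $D(G)$ and adjacency matrix $A(G)$, and for $\alpha\in[0,1]$, let $A_\alpha(G)=\alpha D(G)+(1-\alpha)A(G)$, and let the $A_\alpha$-spectrum of $G$ be the multiset of the roots of the characteristic polynomial $\det(xI-A_\alpha(G))$. A tree is called starlike if it has exactly one vertex of degree greater than $2$. Every starlike tree is determined by its $A_\alpha$-spectrum, where $\alpha$ is regarded as a variable ranging over $[0,1]$. That is, if $G$ is a starlike tree and $H$ is a graph such that $G$ and $H$ have the same $A_\alpha$-spectrum for every $\alpha\in[0,1]$, then $H$ is isomorphic to $G$. -/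

import Mathlib

namespace SimpleGraph

universe u v

/-- The matrix `A_α(G) = α D(G) + (1 - α) A(G)`, with `D(G)` the diagonal matrix of the degrees and
`A(G)` the adjacency matrix of the finite simple graph `G`. -/
def aAlphaMatrix {V : Type u} [Fintype V] [DecidableEq V] (G : SimpleGraph V)
    [DecidableRel G.Adj] (α : ℝ) : Matrix V V ℝ :=
  α • G.degMatrix ℝ + (1 - α) • G.adjMatrix ℝ

/-- The `A_α`-spectrum of `G` at the parameter `α`: the multiset of the roots of the characteristic
polynomial `det (x I - A_α(G))`. As `A_α(G)` is a real symmetric matrix, all roots are real. -/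
noncomputable def aAlphaSpectrum {V : Type u} [Fintype V] [DecidableEq V] (G : SimpleGraph V)
    [DecidableRel G.Adj] (α : ℝ) : Multiset ℝ :=
  (G.aAlphaMatrix α).charpoly.roots

/-- Two finite graphs are `A_α`-cospectral if they have the same `A_α`-spectrum, where `α` is a
variable that ranges over `[0, 1]`: the spectra agree at every value of the parameter. -/
def AAlphaCospectral {V : Type u} {W : Type v} [Fintype V] [DecidableEq V] [Fintype W]
    [DecidableEq W] (G : SimpleGraph V) [DecidableRel G.Adj] (H : SimpleGraph W)
    [DecidableRel H.Adj] : Prop :=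
  ∀ α ∈ Set.Icc (0 : ℝ) 1, G.aAlphaSpectrum α = H.aAlphaSpectrum α

/-- `G` is determined by its `A_α`-spectrum: every finite simple graph that is `A_α`-cospectral
with `G` is isomorphic to `G`. The graph `H` is arbitrary: it may be disconnected and may have
any finite number of vertices. -/
def IsDeterminedByAAlphaSpectrum {V : Type u} [Fintype V] [DecidableEq V] (G : SimpleGraph V)
    [DecidableRel G.Adj] : Prop :=
  ∀ (W : Type v) [Fintype W] [DecidableEq W] (H : SimpleGraph W) [DecidableRel H.Adj],
    AAlphaCospectral G H → Nonempty (G ≃g H)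

/-- A starlike tree: a tree with exactly one vertex of degree greater than two. -/
def IsStarlikeTree {V : Type u} [Fintype V] (G : SimpleGraph V) [DecidableRel G.Adj] : Prop :=
  G.IsTree ∧ ∃! c : V, 2 < G.degree c

end SimpleGraph

open Polynomial

/-! Up to a scalar and a change of variables, `det (x I - A_α)` is the determinant of the pencil `y
I - A - s (D - 2 I)`. Being polynomial in `s`, it is known for every `s` once it is known for `s >
0`.

Three specialisations suffice. At `α = 1` the spectrum is the degree sequence. At `s = -1` the
pencil gives the Laplacian spectrum, hence the number of components; with the edge count this makes
`H` a tree, and its degrees make it a spider. As `s → ∞`, the leading term is the minor of `y I - A`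
on the vertices of degree two, times a nonzero constant fixed by the degrees.

In a spider that minor deletes the body and the leaves, leaving paths on `l i - 1` vertices, so `∏ S
(l i - 1)` is an invariant (`Matrix.det_toSquareBlockProp_eq_of_det_pencil_eq`). The largest root of
this product reveals the longest path; cancelling its factor and repeating recovers all leg lengths,
as their number is the degree of the body. -/

/-! ### Determinants of matrix pencils -/

theorem Matrix.IsHermitian.charpoly_eq_of_roots_eq {V W : Type*} [Fintype V] [DecidableEq V]
    [Fintype W] [DecidableEq W] {A : Matrix V V ℝ} {B : Matrix W W ℝ}
    (hA : A.IsHermitian) (hB : B.IsHermitian) (h : A.charpoly.roots = B.charpoly.roots) :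
    A.charpoly = B.charpoly := by
  rw [hA.splits_charpoly.eq_prod_roots_of_monic A.charpoly_monic,
    hB.splits_charpoly.eq_prod_roots_of_monic B.charpoly_monic, h]

theorem exists_equiv_of_map_univ_eq {V W R : Type*} [Fintype V] [Fintype W]
    {f : V → R} {g : W → R}
    (h : Finset.univ.val.map f = Finset.univ.val.map g) :
    ∃ σ : V ≃ W, ∀ v, g (σ v) = f v := by
  classical
  have key : ∀ c, Fintype.card {v // f v = c} = Fintype.card {w // g w = c} := by
    intro c
    have := congrArg (Multiset.count c) h
    simp only [Multiset.count_map] at this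
    rw [Fintype.card_subtype, Fintype.card_subtype, Finset.card_def, Finset.card_def]
    simpa [Finset.filter_val, eq_comm] using this
  exact ⟨Equiv.ofFiberEquiv fun c => Fintype.equivOfCardEq (key c),
    Equiv.ofFiberEquiv_map _⟩

theorem Matrix.eval_det_pencil {V : Type*} [Fintype V] [DecidableEq V] (M D : Matrix V V ℝ)
    (s : ℝ) : ((M.map C - (X : ℝ[X]) • D.map C).det).eval s = (M - s • D).det := by
  rw [← coe_evalRingHom, RingHom.map_det]
  congr 1
  ext i j
  simp
  ring

/-- Two matrix pencils `M - s Δ` whose determinants agree for all positive `s` have the same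
determinant for every `s`. -/
theorem Matrix.det_pencil_eq_of_forall_pos {V W : Type*} [Fintype V] [DecidableEq V]
    [Fintype W] [DecidableEq W] (M D : Matrix V V ℝ) (N E : Matrix W W ℝ)
    (h : ∀ s : ℝ, 0 < s → (M - s • D).det = (N - s • E).det) (s : ℝ) :
    (M - s • D).det = (N - s • E).det := by
  rw [← eval_det_pencil, ← eval_det_pencil]
  congr 1
  refine eq_of_infinite_eval_eq _ _ ((Set.Ioi_infinite (0 : ℝ)).mono fun t ht => ?_)
  change eval t _ = eval t _
  rw [eval_det_pencil, eval_det_pencil]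
  exact h t ht

/-- If the rows of `M` with `d v ≠ 0` are replaced by zero, the determinant of `M - diagonal d` is
the complementary minor of `M` times the product of the nonzero entries of `-d`. -/
theorem Matrix.det_diagonal_mul_sub {V : Type*} [Fintype V] [DecidableEq V] (M : Matrix V V ℝ)
    (d : V → ℝ) :
    (diagonal (fun v => if d v = 0 then 1 else 0) * M - diagonal d).det =
      (M.toSquareBlockProp fun v => d v = 0).det * ∏ v : {v // ¬ d v = 0}, - d v := by
  rw [twoBlockTriangular_det _ (fun v => d v = 0)]
  · congr 1
    · congr 1
      ext ⟨i, hi⟩ ⟨j, hj⟩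
      simp [toSquareBlockProp, hi, diagonal_apply]
    · rw [← det_diagonal]
      congr 1
      ext ⟨i, hi⟩ ⟨j, hj⟩
      simp [toSquareBlockProp, hi, diagonal_apply]
      split_ifs <;> simp
  · intro i hi j hj
    have : i ≠ j := by rintro rfl; exact hi hj
    simp [hi, this]

theorem Matrix.continuous_det_scaled {V : Type*} [Fintype V] [DecidableEq V] (M : Matrix V V ℝ)
    (d : V → ℝ) : Continuous fun ε : ℝ =>
      (diagonal (fun v => if d v = 0 then 1 else ε) * M - diagonal d).det := by
  refine Continuous.matrix_det (.sub (.mul (.matrix_diagonal ?_) continuous_const)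
    continuous_const)
  refine continuous_pi fun v => ?_
  split_ifs <;> fun_prop

/-- Extracts the leading term as `s → ∞`: with `s = 1 / ε`, scaling the rows where `d v ≠ 0` by `ε`
keeps the determinant bounded, and `ε → 0` isolates the minor. Through `σ`, the scaling factors and
the nonzero constant agree on both sides. -/
theorem Matrix.det_toSquareBlockProp_eq_of_det_pencil_eq {V W : Type*} [Fintype V] [DecidableEq V]
    [Fintype W] [DecidableEq W] (M : Matrix V V ℝ) (N : Matrix W W ℝ) (d : V → ℝ) (e : W → ℝ)
    (σ : V ≃ W) (hσ : ∀ v, e (σ v) = d v)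
    (h : ∀ s : ℝ, (M - s • diagonal d).det = (N - s • diagonal e).det) :
    (M.toSquareBlockProp fun v => d v = 0).det = (N.toSquareBlockProp fun w => e w = 0).det := by
  have scaled : ∀ ε : ℝ, 0 < ε →
      (diagonal (fun v => if d v = 0 then 1 else ε) * M - diagonal d).det =
      (diagonal (fun v => if e v = 0 then 1 else ε) * N - diagonal e).det := by
    intro ε hε
    have h1 : diagonal (fun v => if d v = 0 then 1 else ε) * M - diagonal d =
        diagonal (fun v => if d v = 0 then 1 else ε) * (M - ε⁻¹ • diagonal d) := by
      rw [mul_sub, mul_smul_comm, diagonal_mul_diagonal, ← diagonal_smul]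
      congr 2
      ext v
      by_cases hv : d v = 0 <;> simp [hv, hε.ne']
    have h2 : diagonal (fun v => if e v = 0 then 1 else ε) * N - diagonal e =
        diagonal (fun v => if e v = 0 then 1 else ε) * (N - ε⁻¹ • diagonal e) := by
      rw [mul_sub, mul_smul_comm, diagonal_mul_diagonal, ← diagonal_smul]
      congr 2
      ext v
      by_cases hv : e v = 0 <;> simp [hv, hε.ne']
    rw [h1, h2, det_mul, det_mul, h, det_diagonal, det_diagonal,
      ← σ.prod_comp (fun w => if e w = 0 then 1 else ε)]
    simp only [hσ]
  have lim := tendsto_nhds_unique_of_eventuallyEq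
    (((continuous_det_scaled M d).tendsto 0).mono_left (nhdsWithin_le_nhds (s := Set.Ioi 0)))
    (((continuous_det_scaled N e).tendsto 0).mono_left (nhdsWithin_le_nhds (s := Set.Ioi 0)))
    (by filter_upwards [self_mem_nhdsWithin] with ε hε using scaled ε hε)
  rw [det_diagonal_mul_sub, det_diagonal_mul_sub] at lim
  have hprod : ∏ v : {v // ¬ d v = 0}, - d v = ∏ w : {w // ¬ e w = 0}, - e w := by
    rw [← (σ.subtypeEquiv (p := fun v => ¬ d v = 0) (q := fun w => ¬ e w = 0)
      fun v => by rw [hσ]).prod_comp]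
    simp [hσ]
  rw [hprod] at lim
  refine mul_right_cancel₀ (Finset.prod_ne_zero_iff.mpr fun w _ => ?_) lim
  exact neg_ne_zero.mpr w.2

theorem Matrix.det_blockDiagonal' {ι : Type*} [Fintype ι] [DecidableEq ι] {m : ι → Type*}
    [∀ i, Fintype (m i)] [∀ i, DecidableEq (m i)] {R : Type*} [CommRing R]
    (M : ∀ i, Matrix (m i) (m i) R) : (blockDiagonal' M).det = ∏ i, (M i).det := by
  -- Any order serves: a block diagonal matrix is block triangular for all of them.
  let _ : LinearOrder ι := LinearOrder.lift' (Fintype.equivFin ι) (Fintype.equivFin ι).injective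
  rw [(blockTriangular_blockDiagonal' M).det_fintype]
  refine Finset.prod_congr rfl fun i _ => ?_
  let φ : m i ≃ {x : Σ i, m i // x.1 = i} := Equiv.ofBijective (fun j => ⟨⟨i, j⟩, rfl⟩)
    ⟨fun j k h => by simpa using h, by rintro ⟨⟨_, j⟩, rfl⟩; exact ⟨j, rfl⟩⟩
  rw [← det_submatrix_equiv_self φ]
  congr 1
  ext j k
  exact blockDiagonal'_apply_eq M i j k

/-! ### Characteristic polynomials of paths -/

/-- The matrix `y I - A` of the path on `n` vertices. -/
def pathCharmatrix (y : ℝ) (n : ℕ) : Matrix (Fin n) (Fin n) ℝ :=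
  fun i j => if i = j then y else if i.val + 1 = j.val ∨ j.val + 1 = i.val then -1 else 0

/-- Expansion along the first row, then along the first column of the second minor, gives the
Chebyshev recurrence. -/
theorem det_pathCharmatrix (y : ℝ) : ∀ n : ℕ,
    (pathCharmatrix y n).det = (Chebyshev.S ℝ n).eval y
  | 0 => by simp
  | 1 => by simp [pathCharmatrix]
  | n + 2 => by
    have ih1 := det_pathCharmatrix y (n + 1)
    have ih0 := det_pathCharmatrix y n
    push_cast at ih1 ⊢
    rw [Chebyshev.S_add_two, eval_sub, eval_mul, eval_X, ← ih1, ← ih0]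
    rw [Matrix.det_succ_row_zero, Fin.sum_univ_succ, Fin.sum_univ_succ]
    have h0 : (pathCharmatrix y (n + 2)).submatrix Fin.succ (Fin.succAbove 0) =
        pathCharmatrix y (n + 1) := by
      ext i j
      simp [pathCharmatrix]
    have h1 : ((pathCharmatrix y (n + 2)).submatrix Fin.succ
        (Fin.succAbove (Fin.succ 0))).det = - (pathCharmatrix y n).det := by
      rw [Matrix.det_succ_column_zero, Fin.sum_univ_succ]
      have h2 : (((pathCharmatrix y (n + 2)).submatrix Fin.succ
        (Fin.succAbove (Fin.succ 0))).submatrix (Fin.succAbove 0) Fin.succ) =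
          pathCharmatrix y n := by
        ext i j
        simp [pathCharmatrix, Fin.succAbove, Fin.lt_def]
      rw [h2, Finset.sum_eq_zero]
      · simp [pathCharmatrix, Fin.succAbove]
      · intro i _
        simp [pathCharmatrix, Fin.succAbove, Fin.ext_iff]
    rw [h0, h1, Finset.sum_eq_zero]
    · simp [pathCharmatrix]
      ring
    · intro i _
      simp [pathCharmatrix, Fin.ext_iff]

theorem Multiset.prod_chebyshevS_ne_zero (s : Multiset ℕ) :
    (s.map fun l : ℕ => Chebyshev.S ℝ l).prod ≠ 0 := by
  refine Multiset.prod_ne_zero fun h => ?_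
  obtain ⟨l, -, hl⟩ := Multiset.mem_map.mp h
  have := congrArg (eval 2) hl
  rw [Chebyshev.S_eval_two] at this
  simp at this
  norm_cast at this

/-- The number `2 cos (π / (n + 2))` is a root of `S (n + 1)`, and of no `S m` with `m ≤ n`. -/
theorem chebyshevS_eval_two_mul_cos_eq_zero_iff {n m : ℕ} (hm : m ≤ n + 1) :
    (Chebyshev.S ℝ m).eval (2 * Real.cos (Real.pi / (n + 2))) = 0 ↔ m = n + 1 := by
  have hθ : 0 < Real.sin (Real.pi / (n + 2)) := by
    apply Real.sin_pos_of_pos_of_lt_pi (by positivity)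
    exact div_lt_self Real.pi_pos (by linarith [(Nat.cast_nonneg n : (0 : ℝ) ≤ n)])
  have h := Chebyshev.S_two_mul_real_cos (Real.pi / (n + 2)) m
  push_cast at h
  -- With `θ = π / (n + 2)`, `S m (2 cos θ) sin θ = sin ((m + 1) θ)`, and `(m + 1) θ` lies in `(0,
  -- π]`.
  rw [← mul_eq_zero_iff_right hθ.ne', h]
  have hn : (0 : ℝ) < n + 2 := by positivity
  constructor
  · intro hs
    by_contra hne
    have hlt : (m : ℝ) + 1 < n + 2 := by
      have : m + 1 < n + 2 := by omega
      exact_mod_cast this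
    refine (Real.sin_pos_of_pos_of_lt_pi (by positivity) ?_).ne' hs
    rw [← mul_div_assoc, div_lt_iff₀ hn, mul_comm]
    exact mul_lt_mul_of_pos_left hlt Real.pi_pos
  · rintro rfl
    push_cast
    rw [show ((n : ℝ) + 1 + 1) * (Real.pi / (n + 2)) = Real.pi by field_simp; ring]
    exact Real.sin_pi

/-- A multiset of path lengths is determined by the product of the characteristic polynomials,
once its cardinality is known. -/
theorem Multiset.eq_of_prod_chebyshevS_eq : ∀ (k : ℕ) (s t : Multiset ℕ),
    Multiset.card s = k → Multiset.card t = k →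
    (s.map fun l : ℕ => Chebyshev.S ℝ l).prod = (t.map fun l : ℕ => Chebyshev.S ℝ l).prod →
    s = t := by
  intro k
  induction k with
  | zero =>
    intro s t hs ht _
    rw [Multiset.card_eq_zero.mp hs, Multiset.card_eq_zero.mp ht]
  | succ k ih =>
    have mem_of_max : ∀ (s t : Multiset ℕ) (a : ℕ), a + 1 ∈ s → (∀ b ∈ t, b ≤ a + 1) →
        (s.map fun l : ℕ => Chebyshev.S ℝ l).prod = (t.map fun l : ℕ => Chebyshev.S ℝ l).prod →
        a + 1 ∈ t := by
      intro s t a has hta h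
      have := congrArg (eval (2 * Real.cos (Real.pi / (a + 2)))) h
      rw [eval_multiset_prod, eval_multiset_prod, Multiset.map_map, Multiset.map_map,
        Multiset.prod_eq_zero (Multiset.mem_map.mpr ⟨a + 1, has,
          (chebyshevS_eval_two_mul_cos_eq_zero_iff le_rfl).mpr rfl⟩), eq_comm,
        Multiset.prod_eq_zero_iff] at this
      obtain ⟨b, hb, hb0⟩ := Multiset.mem_map.mp this
      rwa [← (chebyshevS_eval_two_mul_cos_eq_zero_iff (hta b hb)).mp hb0]
    have exists_max : ∀ s : Multiset ℕ, Multiset.card s = k + 1 →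
        ∃ a ∈ s, ∀ b ∈ s, b ≤ a := by
      intro s hs
      have hne : s.toFinset.Nonempty := by
        obtain ⟨a, ha⟩ := Multiset.card_pos_iff_exists_mem.mp (by omega : 0 < Multiset.card s)
        exact ⟨a, Multiset.mem_toFinset.mpr ha⟩
      obtain ⟨a, ha, hmax⟩ := s.toFinset.exists_max_image id hne
      exact ⟨a, Multiset.mem_toFinset.mp ha, fun b hb => hmax b (Multiset.mem_toFinset.mpr hb)⟩
    intro s t hs ht h
    obtain ⟨a, has, hmaxs⟩ := exists_max s hs
    obtain ⟨b, hbt, hmaxt⟩ := exists_max t ht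
    have hab : a = b := by
      rcases lt_trichotomy a b with hlt | heq | hlt
      -- The larger maximum is positive, so its polynomial has a root that must also come from the
      -- other multiset.
      · obtain ⟨c, rfl⟩ : ∃ c, b = c + 1 := ⟨b - 1, by omega⟩
        have := hmaxs _ (mem_of_max t s c hbt (fun d hd => (hmaxs d hd).trans hlt.le) h.symm)
        omega
      · exact heq
      · obtain ⟨c, rfl⟩ : ∃ c, a = c + 1 := ⟨a - 1, by omega⟩
        have := hmaxt _ (mem_of_max s t c has (fun d hd => (hmaxt d hd).trans hlt.le) h)
        omega
    subst hab
    obtain ⟨s', rfl⟩ := Multiset.exists_cons_of_mem has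
    obtain ⟨t', rfl⟩ := Multiset.exists_cons_of_mem hbt
    simp only [Multiset.map_cons, Multiset.prod_cons, Multiset.card_cons, Nat.add_right_cancel_iff]
      at h hs ht
    have ha0 : Chebyshev.S ℝ a ≠ 0 := by
      simpa using Multiset.prod_chebyshevS_ne_zero {a}
    rw [ih s' t' hs ht (mul_left_cancel₀ ha0 h)]

/-! ### Spiders -/

namespace SimpleGraph

section Spider

variable {ι : Type*} (l : ι → ℕ)

/-- The spider whose legs, indexed by `ι`, have lengths `l i`: the vertex `none` is the body, and
`some ⟨i, j⟩` is the vertex at distance `j + 1` from the body on the leg `i`. -/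
def spider : SimpleGraph (Option (Σ i, Fin (l i))) where
  Adj
    | none, none => False
    | none, some y => y.2.val = 0
    | some x, none => x.2.val = 0
    | some x, some y => x.1 = y.1 ∧ (x.2.val + 1 = y.2.val ∨ y.2.val + 1 = x.2.val)
  symm := ⟨by
    rintro (_ | x) (_ | y) h
    · exact h
    · exact h
    · exact h
    · exact ⟨h.1.symm, h.2.symm⟩⟩
  loopless := ⟨by
    rintro (_ | x) h
    · exact h
    · omega⟩

variable {l}

theorem spider_adj_none_some {y : Σ i, Fin (l i)} :
    (spider l).Adj none (some y) ↔ y.2.val = 0 := Iff.rfl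

theorem spider_adj_some_none {y : Σ i, Fin (l i)} :
    (spider l).Adj (some y) none ↔ y.2.val = 0 := Iff.rfl

theorem spider_adj_some_some {x y : Σ i, Fin (l i)} :
    (spider l).Adj (some x) (some y) ↔
      x.1 = y.1 ∧ (x.2.val + 1 = y.2.val ∨ y.2.val + 1 = x.2.val) := Iff.rfl

/-- The neighbour of a leg vertex on its side towards the body. -/
def spiderPrev (i : ι) (j : Fin (l i)) : Option (Σ i, Fin (l i)) :=
  if j.val = 0 then none else some ⟨i, ⟨j.val - 1, by omega⟩⟩

theorem spider_adj_some_iff {i : ι} {j : Fin (l i)} {x : Option (Σ i, Fin (l i))} :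
    (spider l).Adj (some ⟨i, j⟩) x ↔
      x = spiderPrev i j ∨ ∃ h : j.val + 1 < l i, x = some ⟨i, ⟨j.val + 1, h⟩⟩ := by
  rcases x with _ | ⟨i', j'⟩
  · rw [spider_adj_some_none]
    unfold spiderPrev
    split_ifs <;> simp_all
  · rw [spider_adj_some_some]
    unfold spiderPrev
    constructor
    · rintro ⟨rfl, h | h⟩
      · right
        exact ⟨h ▸ j'.2, by simp [h]⟩
      · left
        have h' : ¬ j.val = 0 := by simp at h; omega
        rw [if_neg h']
        simp only at h
        simp [← h]
    · rintro (h | ⟨h, h'⟩)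
      · split_ifs at h with h0
        rw [Option.some_inj] at h
        obtain ⟨rfl, h⟩ := Sigma.mk.inj h
        refine ⟨rfl, Or.inr ?_⟩
        rw [eq_of_heq h]
        simp only
        omega
      · rw [Option.some_inj] at h'
        obtain ⟨rfl, h'⟩ := Sigma.mk.inj h'
        refine ⟨rfl, Or.inl ?_⟩
        rw [eq_of_heq h']

theorem degree_spider_some (i : ι) (j : Fin (l i))
    [Fintype ((spider l).neighborSet (some ⟨i, j⟩))] :
    (spider l).degree (some ⟨i, j⟩) = if j.val + 1 < l i then 2 else 1 := by
  classical
  rw [← card_neighborFinset_eq_degree]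
  split_ifs with h
  · have : (spider l).neighborFinset (some ⟨i, j⟩) =
        {spiderPrev i j, some ⟨i, ⟨j.val + 1, h⟩⟩} := by
      ext x
      simp [spider_adj_some_iff, h]
    rw [this, Finset.card_pair]
    unfold spiderPrev
    split_ifs
    · simp
    · intro hh
      rw [Option.some_inj] at hh
      have := congrArg Fin.val (eq_of_heq (Sigma.mk.inj hh).2)
      simp at this
  · have : (spider l).neighborFinset (some ⟨i, j⟩) = {spiderPrev i j} := by
      ext x
      simp [spider_adj_some_iff, h]
    rw [this, Finset.card_singleton]

/-- Spiders with the same leg lengths are isomorphic. -/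
def spiderIso {κ : Type*} {m : κ → ℕ} (σ : ι ≃ κ) (h : ∀ i, l i = m (σ i)) :
    spider l ≃g spider m where
  toEquiv := Equiv.optionCongr (Equiv.sigmaCongr σ fun i => finCongr (h i))
  map_rel_iff' := by
    rintro (_ | ⟨i, j⟩) (_ | ⟨i', j'⟩)
    · exact Iff.rfl
    · exact Iff.rfl
    · exact Iff.rfl
    · change σ i = σ i' ∧ (j.val + 1 = j'.val ∨ j'.val + 1 = j.val) ↔ _
      rw [σ.injective.eq_iff]
      exact Iff.rfl

end Spider

/-! ### Trees with at most one branching vertex are spiders -/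

section Tree

variable {V : Type*} {G : SimpleGraph V}

theorem IsTree.exists_parent (hG : G.IsTree) (c : V) {v : V} (hv : v ≠ c) :
    ∃ p, G.Adj p v ∧ G.dist c v = G.dist c p + 1 := by
  obtain ⟨w, hw⟩ := hG.connected.exists_walk_length_eq_dist c v
  have hn : ¬ w.Nil := Walk.not_nil_of_ne hv.symm
  have hadj := w.adj_penultimate hn
  refine ⟨w.penultimate, hadj, ?_⟩
  have h1 := dist_le w.dropLast
  have h2 := w.length_dropLast_add_one hn
  rcases hG.dist_eq_dist_add_one_of_adj c hadj with h | h <;> omega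

/-- Geodesics from `c` to `p` and to `q`, extended to `v`, are both paths, and a tree has only one
path from `c` to `v`. -/
theorem IsTree.parent_unique (hG : G.IsTree) (c : V) {v p q : V} (hp : G.Adj p v)
    (hp' : G.dist c v = G.dist c p + 1) (hq : G.Adj q v) (hq' : G.dist c v = G.dist c q + 1) :
    p = q := by
  obtain ⟨wp, hwp⟩ := hG.connected.exists_walk_length_eq_dist c p
  obtain ⟨wq, hwq⟩ := hG.connected.exists_walk_length_eq_dist c q
  have h1 : (wp.concat hp).IsPath := Walk.isPath_of_length_eq_dist _ (by simp [hwp, hp'])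
  have h2 : (wq.concat hq).IsPath := Walk.isPath_of_length_eq_dist _ (by simp [hwq, hq'])
  have := (hG.existsUnique_path c v).unique h1 h2
  simpa using congrArg Walk.penultimate this

/-- In a tree in which all vertices but `c` have degree at most two, the branch at `c` and the
distance from `c` are coordinates that describe the adjacency. -/
theorem IsTree.exists_branch [Fintype V] [DecidableRel G.Adj] (hG : G.IsTree) (c : V)
    (hdeg : ∀ v, v ≠ c → G.degree v ≤ 2) :
    ∃ b : V → V, (∀ v, v ≠ c → G.Adj c (b v)) ∧
      (∀ v, G.Adj c v → b v = v) ∧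
      (∀ u v, u ≠ c → v ≠ c → b u = b v → G.dist c u = G.dist c v → u = v) ∧
      (∀ u v, u ≠ c → v ≠ c → (G.Adj u v ↔ b u = b v ∧
        (G.dist c u + 1 = G.dist c v ∨ G.dist c v + 1 = G.dist c u))) ∧
      (∀ v k, v ≠ c → 1 ≤ k → k ≤ G.dist c v → ∃ u, u ≠ c ∧ b u = b v ∧ G.dist c u = k) := by
  classical
  have hpar : ∀ v, ∃ p, v ≠ c → G.Adj p v ∧ G.dist c v = G.dist c p + 1 := fun v => by
    by_cases hv : v = c
    · exact ⟨v, fun h => absurd hv h⟩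
    · obtain ⟨p, hp⟩ := hG.exists_parent c hv
      exact ⟨p, fun _ => hp⟩
  choose par hpar using hpar
  have dist_ne : ∀ {v}, G.dist c v ≠ 0 ↔ v ≠ c := fun {v} => by
    rw [ne_eq, hG.connected.dist_eq_zero_iff, eq_comm]
  have dist_iter : ∀ k v, k ≤ G.dist c v → G.dist c (par^[k] v) + k = G.dist c v := by
    intro k
    induction k with
    | zero => intro v _; rfl
    | succ k ih =>
      intro v hk
      rw [Function.iterate_succ_apply']
      have h1 := ih v (by omega)
      have h2 := (hpar (par^[k] v) (dist_ne.mp (by omega))).2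
      omega
  -- The ancestor of `v` adjacent to `c`; at `v = c` truncated subtraction gives the irrelevant
  -- value `c`.
  set b : V → V := fun v => par^[G.dist c v - 1] v with hb
  have b_par : ∀ v, 2 ≤ G.dist c v → b (par v) = b v := by
    intro v hv
    have h2 := (hpar v (dist_ne.mp (by omega))).2
    simp only [hb]
    rw [← Function.iterate_succ_apply]
    congr 2
    omega
  have b_iter : ∀ k v, k < G.dist c v → b (par^[k] v) = b v := by
    intro k
    induction k with
    | zero => intro v _; rfl
    | succ k ih =>
      intro v hk
      have := dist_iter k v (by omega)
      rw [Function.iterate_succ_apply', b_par _ (by omega), ih v (by omega)]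
  have b_inj : ∀ n u v, G.dist c u = n + 1 → G.dist c v = n + 1 → b u = b v → u = v := by
    intro n
    induction n with
    | zero =>
      intro u v hu hv h
      simpa [hb, hu, hv] using h
    | succ n ih =>
      intro u v hu hv h
      obtain ⟨au, du⟩ := hpar u (dist_ne.mp (by omega))
      obtain ⟨av, dv⟩ := hpar v (dist_ne.mp (by omega))
      have hp : par u = par v := ih _ _ (by omega) (by omega)
        (by rw [b_par u (by omega), b_par v (by omega), h])
      -- Two distinct children and the parent of `par u` would be three neighbours of a vertex other
      -- than `c`.
      by_contra hne
      have hpc : par u ≠ c := dist_ne.mp (by omega)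
      obtain ⟨aq, dq⟩ := hpar (par u) hpc
      have hsub : ({u, v, par (par u)} : Finset V) ⊆ G.neighborFinset (par u) := by
        intro x hx
        simp only [Finset.mem_insert, Finset.mem_singleton] at hx
        rw [mem_neighborFinset]
        rcases hx with rfl | rfl | rfl
        · exact au
        · rw [hp]; exact av
        · exact aq.symm
      have h3 : ({u, v, par (par u)} : Finset V).card = 3 := by
        rw [Finset.card_eq_three]
        refine ⟨u, v, par (par u), hne, ?_, ?_, rfl⟩
        · intro h; have := congrArg (G.dist c) h; omega
        · intro h; have := congrArg (G.dist c) h; omega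
      have := Finset.card_le_card hsub
      rw [h3, card_neighborFinset_eq_degree] at this
      have := hdeg _ hpc
      omega
  have adj_down : ∀ u v, u ≠ c → G.Adj u v → G.dist c v = G.dist c u + 1 → b u = b v := by
    intro u v hu ha hd
    obtain ⟨av, dv⟩ := hpar v (dist_ne.mp (by omega))
    have hu' := dist_ne.mpr hu
    rw [hG.parent_unique c ha hd av dv, b_par v (by omega)]
  have adj_up : ∀ u v, u ≠ c → b u = b v → G.dist c v = G.dist c u + 1 → G.Adj u v := by
    intro u v hu h hd
    obtain ⟨av, dv⟩ := hpar v (dist_ne.mp (by omega))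
    have hu' := dist_ne.mpr hu
    rwa [b_inj (G.dist c u - 1) u (par v) (by omega) (by omega)
      (by rw [h, b_par v (by omega)])]
  refine ⟨b, ?_, ?_, ?_, ?_, ?_⟩
  · intro v hv
    have h1 := dist_ne.mpr hv
    have := dist_iter (G.dist c v - 1) v (by omega)
    rw [← dist_eq_one_iff_adj]
    simp only [hb]
    omega
  · intro v hv
    simp [hb, dist_eq_one_iff_adj.mpr hv]
  · intro u v hu hv h hd
    have := dist_ne.mpr hu
    exact b_inj (G.dist c u - 1) u v (by omega) (by omega) h
  · intro u v hu hv
    constructor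
    · intro ha
      rcases hG.dist_eq_dist_add_one_of_adj c ha with hd | hd
      · exact ⟨(adj_down v u hv ha.symm hd).symm, Or.inr hd.symm⟩
      · exact ⟨adj_down u v hu ha hd, Or.inl hd.symm⟩
    · rintro ⟨h, hd | hd⟩
      · exact adj_up u v hu h hd.symm
      · exact (adj_up v u hv h.symm hd.symm).symm
  · intro v k hv hk hkv
    have := dist_iter (G.dist c v - k) v (by omega)
    exact ⟨par^[G.dist c v - k] v, dist_ne.mp (by omega), b_iter _ v (by omega), by omega⟩

/-- A tree in which all vertices but `c` have degree at most two is a spider. -/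
theorem IsTree.exists_iso_spider [Fintype V] [DecidableRel G.Adj] (hG : G.IsTree) (c : V)
    (hdeg : ∀ v, v ≠ c → G.degree v ≤ 2) :
    ∃ l : G.neighborSet c → ℕ, (∀ i, 0 < l i) ∧ ∃ e : G ≃g spider l, e c = none := by
  classical
  obtain ⟨b, hbc, hb1, hinj, hadj, hdown⟩ := hG.exists_branch c hdeg
  have dist_pos : ∀ {v}, v ≠ c → 1 ≤ G.dist c v := fun {v} hv =>
    hG.connected.pos_dist_of_ne hv.symm
  let S : G.neighborSet c → Finset V := fun i => Finset.univ.filter fun v => v ≠ c ∧ b v = i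
  have mem_S : ∀ {i v}, v ∈ S i ↔ v ≠ c ∧ b v = i := by simp [S]
  -- A leg is as long as its deepest vertex is far from `c`; the ancestors of that vertex fill every
  -- smaller distance.
  let l : G.neighborSet c → ℕ := fun i => (S i).sup (G.dist c)
  have self_mem : ∀ i : G.neighborSet c, (i : V) ∈ S i := fun i =>
    mem_S.mpr ⟨(G.ne_of_adj i.2).symm, hb1 i i.2⟩
  have hl : ∀ i, 0 < l i := fun i =>
    (dist_pos (mem_S.mp (self_mem i)).1).trans (Finset.le_sup (f := G.dist c) (self_mem i))
  have hex : ∀ x : Σ i, Fin (l i), ∃ u, u ≠ c ∧ b u = x.1 ∧ G.dist c u = x.2.val + 1 := by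
    rintro ⟨i, j⟩
    obtain ⟨v, hv, hvl⟩ := Finset.exists_mem_eq_sup (S i) ⟨_, self_mem i⟩ (G.dist c)
    obtain ⟨hvc, hvb⟩ := mem_S.mp hv
    have hj : j.val < G.dist c v := hvl ▸ j.2
    obtain ⟨u, hu, hub, hud⟩ := hdown v (j.val + 1) hvc (by omega) (by omega)
    exact ⟨u, hu, hub.trans hvb, hud⟩
  choose g hgc hgb hgd using hex
  let f : Option (Σ i, Fin (l i)) → V := fun x => x.elim c g
  have hf : Function.Bijective f := by
    constructor
    · rintro (_ | ⟨i, j⟩) (_ | ⟨i', j'⟩) h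
      · rfl
      · exact absurd h.symm (hgc _)
      · exact absurd h (hgc _)
      · change g _ = g _ at h
        have h1 := hgb ⟨i, j⟩
        have h2 := hgd ⟨i, j⟩
        rw [h, hgb] at h1
        rw [h, hgd] at h2
        simp only at h1 h2
        obtain rfl := Subtype.ext h1
        have : j = j' := Fin.ext (by omega)
        rw [this]
    · intro v
      by_cases hv : v = c
      · exact ⟨none, hv.symm⟩
      · have h1 := dist_pos hv
        have h2 : G.dist c v ≤ l ⟨b v, hbc v hv⟩ :=
          Finset.le_sup (f := G.dist c) (mem_S.mpr ⟨hv, rfl⟩)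
        refine ⟨some ⟨⟨b v, hbc v hv⟩, ⟨G.dist c v - 1, by omega⟩⟩, ?_⟩
        refine hinj _ _ (hgc _) hv (hgb _) ?_
        change G.dist c (g _) = _
        rw [hgd]
        simp only
        omega
  let e : spider l ≃g G :=
    { toEquiv := Equiv.ofBijective f hf
      map_rel_iff' := by
        rintro (_ | x) (_ | y)
        · exact iff_of_false (G.loopless.irrefl c) (fun h => h)
        · change G.Adj c (g y) ↔ _
          rw [spider_adj_none_some, ← dist_eq_one_iff_adj, hgd]
          simp
        · change G.Adj (g x) c ↔ _
          rw [spider_adj_some_none, adj_comm, ← dist_eq_one_iff_adj, hgd]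
          omega
        · change G.Adj (g x) (g y) ↔ _
          rw [spider_adj_some_some, hadj _ _ (hgc x) (hgc y), hgb, hgb, hgd, hgd,
            Subtype.coe_inj]
          exact and_congr_right fun _ => by omega }
  exact ⟨l, hl, e.symm, e.symm_apply_apply none⟩

/-- The minor of `y I - A` on the vertices of degree two of a spider is the product of the
characteristic polynomials of the paths that remain of the legs. -/
theorem det_toSquareBlockProp_of_iso_spider [Fintype V] [DecidableEq V] [DecidableRel G.Adj]
    {ι : Type*} [Fintype ι] {l : ι → ℕ} (e : G ≃g spider l) (h2 : G.degree (e.symm none) ≠ 2)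
    (p : V → Prop) [DecidablePred p] (hp : ∀ v, p v ↔ G.degree v = 2) (y : ℝ) :
    ((Matrix.diagonal (fun _ => y) - G.adjMatrix ℝ).toSquareBlockProp p).det =
      ∏ i, (Chebyshev.S ℝ ((l i - 1 : ℕ) : ℤ)).eval y := by
  classical
  have hdeg : ∀ i (j : Fin (l i)), G.degree (e.symm (some ⟨i, j⟩)) = 2 ↔ j.val + 1 < l i := by
    intro i j
    rw [← e.degree_eq (e.symm (some ⟨i, j⟩))]
    have := degree_spider_some i j
    rw [e.apply_symm_apply]
    simp [this]
  let f : (Σ i, Fin (l i - 1)) → {v // p v} := fun x =>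
    ⟨e.symm (some ⟨x.1, ⟨x.2.val, by omega⟩⟩), (hp _).mpr ((hdeg _ _).mpr (by simp; omega))⟩
  have hf : Function.Bijective f := by
    constructor
    · rintro ⟨i, j⟩ ⟨i', j'⟩ h
      have h := Option.some_inj.mp (e.symm.injective (Subtype.ext_iff.mp h))
      obtain ⟨h1, h3⟩ := Sigma.mk.inj h
      simp only at h1
      subst h1
      have := congrArg Fin.val (eq_of_heq h3)
      simp only at this
      rw [Fin.ext this]
    · rintro ⟨v, hv⟩
      rw [hp] at hv
      obtain ⟨x, rfl⟩ := e.symm.surjective v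
      rcases x with _ | ⟨i, j⟩
      · exact absurd hv h2
      · have := (hdeg i j).mp hv
        exact ⟨⟨i, ⟨j.val, by omega⟩⟩, rfl⟩
  rw [← Matrix.det_submatrix_equiv_self (Equiv.ofBijective f hf)]
  have key : ((Matrix.diagonal (fun _ => y) - G.adjMatrix ℝ).toSquareBlockProp p).submatrix
      (Equiv.ofBijective f hf) (Equiv.ofBijective f hf) =
      Matrix.blockDiagonal' fun i => pathCharmatrix y (l i - 1) := by
    ext ⟨i, j⟩ ⟨i', j'⟩
    have hadj : G.Adj (f ⟨i, j⟩ : V) (f ⟨i', j'⟩) ↔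
        i = i' ∧ (j.val + 1 = j'.val ∨ j'.val + 1 = j.val) := by
      simp only [f]
      rw [e.symm.map_adj_iff, spider_adj_some_some]
    have heq : (f ⟨i, j⟩ : V) = f ⟨i', j'⟩ ↔ (⟨i, j⟩ : Σ i, Fin (l i - 1)) = ⟨i', j'⟩ := by
      rw [Subtype.coe_inj, hf.injective.eq_iff]
    change Matrix.diagonal (fun _ => y) (f ⟨i, j⟩ : V) (f ⟨i', j'⟩) -
      G.adjMatrix ℝ (f ⟨i, j⟩ : V) (f ⟨i', j'⟩) = _
    rw [Matrix.diagonal_apply, adjMatrix_apply]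
    simp only [hadj, heq]
    by_cases hi : i = i'
    · subst hi
      rw [Matrix.blockDiagonal'_apply_eq]
      unfold pathCharmatrix
      by_cases hj : j = j'
      · subst hj; simp
      · simp [hj]
        split_ifs <;> simp
    · rw [Matrix.blockDiagonal'_apply_ne _ _ _ hi]
      simp [hi]
  rw [key, Matrix.det_blockDiagonal']
  exact Finset.prod_congr rfl fun i _ => det_pathCharmatrix y _

end Tree

end SimpleGraph

/-! ### Invariants of the `A_α`-spectrum -/

namespace SimpleGraph

theorem connected_iff_card_connectedComponent {U : Type*} (K : SimpleGraph U)
    [Fintype K.ConnectedComponent] :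
    K.Connected ↔ Fintype.card K.ConnectedComponent = 1 := by
  rw [Fintype.card_eq_one_iff_nonempty_unique]
  constructor
  · intro h
    have := h.preconnected.subsingleton_connectedComponent
    have := h.nonempty
    exact ⟨_root_.uniqueOfSubsingleton (K.connectedComponentMk (Classical.arbitrary U))⟩
  · rintro ⟨h⟩
    have : Nonempty U := h.default.exists_rep.nonempty
    exact ⟨fun u v => ConnectedComponent.exact (Subsingleton.elim _ _)⟩

variable {V W : Type*} [Fintype V] [DecidableEq V] [Fintype W] [DecidableEq W]
  {G : SimpleGraph V} [DecidableRel G.Adj] {H : SimpleGraph W} [DecidableRel H.Adj]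

theorem isHermitian_aAlphaMatrix (G : SimpleGraph V) [DecidableRel G.Adj] (α : ℝ) :
    (G.aAlphaMatrix α).IsHermitian := by
  unfold aAlphaMatrix Matrix.IsHermitian
  rw [Matrix.conjTranspose_add, Matrix.conjTranspose_smul, Matrix.conjTranspose_smul,
    (G.isHermitian_degMatrix ℝ).eq, (G.isHermitian_adjMatrix ℝ).eq]
  simp

theorem AAlphaCospectral.charpoly_eq (h : AAlphaCospectral G H) {α : ℝ}
    (hα : α ∈ Set.Icc (0 : ℝ) 1) :
    (G.aAlphaMatrix α).charpoly = (H.aAlphaMatrix α).charpoly :=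
  (isHermitian_aAlphaMatrix G α).charpoly_eq_of_roots_eq (isHermitian_aAlphaMatrix H α) (h α hα)

theorem AAlphaCospectral.card_eq (h : AAlphaCospectral G H) : Fintype.card V = Fintype.card W := by
  simpa using congrArg natDegree (h.charpoly_eq (α := 0) (by simp))

theorem aAlphaSpectrum_one (G : SimpleGraph V) [DecidableRel G.Adj] :
    G.aAlphaSpectrum 1 = Finset.univ.val.map fun v => (G.degree v : ℝ) := by
  have : G.aAlphaMatrix 1 = Matrix.diagonal fun v => (G.degree v : ℝ) := by
    simp [aAlphaMatrix, degMatrix]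
  rw [aAlphaSpectrum, this, Matrix.charpoly_diagonal]
  exact roots_multiset_prod_X_sub_C (Finset.univ.val.map fun v => (G.degree v : ℝ)) ▸ by
    rw [Multiset.map_map]; rfl

theorem AAlphaCospectral.exists_equiv_degree (h : AAlphaCospectral G H) :
    ∃ σ : V ≃ W, ∀ v, H.degree (σ v) = G.degree v := by
  obtain ⟨σ, hσ⟩ := exists_equiv_of_map_univ_eq
    (by simpa only [aAlphaSpectrum_one] using h 1 (by simp))
  exact ⟨σ, fun v => by exact_mod_cast hσ v⟩

/-- The substitution `α = s / (1 + s)` keeps `α` in `[0, 1]` for `s > 0`. The shift by `2` makes the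
coefficient of `s` vanish exactly at the vertices of degree two. -/
theorem smul_scalar_sub_aAlphaMatrix (G : SimpleGraph V) [DecidableRel G.Adj] (y : ℝ) {s : ℝ}
    (hs : 0 < s) :
    Matrix.diagonal (fun _ => y) - G.adjMatrix ℝ -
        s • Matrix.diagonal (fun v => (G.degree v : ℝ) - 2) =
      (1 + s) • (Matrix.scalar V ((y + 2 * s) / (1 + s)) - G.aAlphaMatrix (s / (1 + s))) := by
  have : 1 + s ≠ 0 := by positivity
  ext i j
  by_cases hij : i = j
  · subst hij
    simp [aAlphaMatrix, degMatrix]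
    field_simp
    ring
  · simp [aAlphaMatrix, degMatrix, hij]
    field_simp
    ring_nf

theorem AAlphaCospectral.det_pencil_eq (h : AAlphaCospectral G H) (y s : ℝ) :
    (Matrix.diagonal (fun _ => y) - G.adjMatrix ℝ -
        s • Matrix.diagonal (fun v => (G.degree v : ℝ) - 2)).det =
      (Matrix.diagonal (fun _ => y) - H.adjMatrix ℝ -
        s • Matrix.diagonal (fun v => (H.degree v : ℝ) - 2)).det := by
  refine Matrix.det_pencil_eq_of_forall_pos _ _ _ _ (fun s hs => ?_) s
  rw [smul_scalar_sub_aAlphaMatrix G y hs, smul_scalar_sub_aAlphaMatrix H y hs,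
    Matrix.det_smul, Matrix.det_smul, h.card_eq, ← Matrix.eval_charpoly, ← Matrix.eval_charpoly,
    h.charpoly_eq]
  exact ⟨by positivity, (div_le_one (by positivity)).mpr (by linarith)⟩

theorem AAlphaCospectral.charpoly_neg_lapMatrix_eq (h : AAlphaCospectral G H) :
    (-G.lapMatrix ℝ).charpoly = (-H.lapMatrix ℝ).charpoly := by
  refine Polynomial.funext fun x => ?_
  rw [Matrix.eval_charpoly, Matrix.eval_charpoly]
  -- At `s = -1` the pencil is `(y - 2) I + D - A`, that is `x I + L`.
  have key := h.det_pencil_eq (x + 2) (-1)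
  convert key using 2
  · ext i j
    by_cases hij : i = j
    · subst hij; simp [lapMatrix, degMatrix]; ring
    · simp [lapMatrix, degMatrix, hij]
  · ext i j
    by_cases hij : i = j
    · subst hij; simp [lapMatrix, degMatrix]; ring
    · simp [lapMatrix, degMatrix, hij]

/-- The Laplacian kernel has one dimension per component, and for a symmetric matrix geometric and
algebraic multiplicities coincide. -/
theorem card_connectedComponent_eq_count_roots (G : SimpleGraph V) [DecidableRel G.Adj]
    [Fintype G.ConnectedComponent] :
    Fintype.card G.ConnectedComponent = (-G.lapMatrix ℝ).charpoly.roots.count 0 := by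
  classical
  have hL : (-G.lapMatrix ℝ).IsHermitian := (G.isHermitian_lapMatrix ℝ).neg
  have h1 := G.card_connectedComponent_eq_finrank_ker_toLin'_lapMatrix
  have hker : (G.lapMatrix ℝ).toLin'.ker = (-G.lapMatrix ℝ).toLin'.ker := by
    ext x
    simp
  rw [hker] at h1
  have h2 := (-G.lapMatrix ℝ).toLin'.finrank_range_add_finrank_ker
  have h3 := hL.rank_eq_card_non_zero_eigs
  rw [Matrix.rank_eq_finrank_range_toLin _ (Pi.basisFun ℝ V) (Pi.basisFun ℝ V),
    Matrix.toLin_eq_toLin'] at h3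
  rw [hL.roots_charpoly_eq_eigenvalues, Multiset.count_map]
  have h4 := Fintype.card_subtype_compl fun i => hL.eigenvalues i = 0
  have h5 := Fintype.card_subtype_le fun i => hL.eigenvalues i = 0
  have h6 : (Multiset.filter (fun a => (0 : ℝ) = (RCLike.ofReal ∘ hL.eigenvalues) a)
      Finset.univ.val).card = Fintype.card {i // hL.eigenvalues i = 0} := by
    rw [Fintype.card_subtype, Finset.card_def, Finset.filter_val]
    simp [eq_comm]
  rw [Module.finrank_fintype_fun_eq_card] at h2
  rw [h6]
  simp only [ne_eq] at h3
  have h7 : Fintype.card G.ConnectedComponent =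
    Module.finrank ℝ (Matrix.toLin' (-G.lapMatrix ℝ)).ker := by convert h1
  omega

theorem AAlphaCospectral.isTree (h : AAlphaCospectral G H) (hG : G.IsTree) : H.IsTree := by
  classical
  obtain ⟨σ, hσ⟩ := h.exists_equiv_degree
  rw [isTree_iff_connected_and_card] at hG ⊢
  constructor
  · have := (connected_iff_card_connectedComponent G).mp hG.1
    rw [connected_iff_card_connectedComponent]
    rwa [card_connectedComponent_eq_count_roots, ← h.charpoly_neg_lapMatrix_eq,
      ← card_connectedComponent_eq_count_roots]
  · have h1 := G.sum_degrees_eq_twice_card_edges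
    have h2 := H.sum_degrees_eq_twice_card_edges
    rw [← σ.sum_comp] at h2
    simp only [hσ] at h2
    have h3 := hG.2
    rw [Nat.card_eq_fintype_card, Nat.card_eq_fintype_card, ← edgeFinset_card] at h3 ⊢
    rw [← h.card_eq]
    omega

end SimpleGraph

/-! ### Recovering the leg lengths -/

open SimpleGraph

universe u v

theorem corollary4p4 {V : Type u} [Fintype V] [DecidableEq V] (G : SimpleGraph V)
    [DecidableRel G.Adj] (hG : G.IsStarlikeTree) :
    SimpleGraph.IsDeterminedByAAlphaSpectrum.{u, v} G := by
  intro W _ _ H _ h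
  classical
  obtain ⟨hT, c, hc, huniq⟩ := hG
  obtain ⟨σ, hσ⟩ := h.exists_equiv_degree
  have hdegG : ∀ v, v ≠ c → G.degree v ≤ 2 := fun v hv =>
    not_lt.mp fun hlt => hv (huniq v hlt)
  have hdegH : ∀ w, w ≠ σ c → H.degree w ≤ 2 := fun w hw => by
    rw [← σ.apply_symm_apply w, hσ]
    exact hdegG _ fun hh => hw (by rw [← hh, σ.apply_symm_apply])
  obtain ⟨l, hl, e, he⟩ := hT.exists_iso_spider c hdegG
  obtain ⟨m, hm, f, hf⟩ := (h.isTree hT).exists_iso_spider (σ c) hdegH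
  have hminor : ∀ y : ℝ, _ := fun y =>
    Matrix.det_toSquareBlockProp_eq_of_det_pencil_eq _ _ _ _ σ (fun v => by rw [hσ])
      (h.det_pencil_eq y)
  have he2 : G.degree (e.symm none) ≠ 2 := by
    rw [← he, e.symm_apply_apply]; omega
  have hf2 : H.degree (f.symm none) ≠ 2 := by
    rw [← hf, f.symm_apply_apply, hσ]; omega
  have two : ∀ n : ℕ, (n : ℝ) - 2 = 0 ↔ n = 2 := fun n => by
    rw [sub_eq_zero]; norm_cast
  have hprod : ∏ i, Chebyshev.S ℝ ((l i - 1 : ℕ) : ℤ) =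
      ∏ i, Chebyshev.S ℝ ((m i - 1 : ℕ) : ℤ) := by
    refine Polynomial.funext fun y => ?_
    rw [eval_prod, eval_prod,
      ← det_toSquareBlockProp_of_iso_spider e he2 _ (fun v => two (G.degree v)) y,
      ← det_toSquareBlockProp_of_iso_spider f hf2 _ (fun v => two (H.degree v)) y]
    exact hminor y
  -- Legs of length one contribute the factor `S 0 = 1`, invisible in the product; the common degree
  -- of the bodies accounts for them.
  have hmult := Multiset.eq_of_prod_chebyshevS_eq (G.degree c)
    (Finset.univ.val.map fun i => l i - 1) (Finset.univ.val.map fun i => m i - 1)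
    (by rw [Multiset.card_map]; exact G.card_neighborSet_eq_degree c)
    (by rw [Multiset.card_map, ← hσ]; exact H.card_neighborSet_eq_degree (σ c))
    (by rw [Multiset.map_map, Multiset.map_map]; exact hprod)
  obtain ⟨τ, hτ⟩ := exists_equiv_of_map_univ_eq hmult
  exact ⟨(e.trans (spiderIso τ fun i => by
    have := hτ i
    have := hl i
    have := hm (τ i)
    omega)).trans f.symm⟩
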